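/- **Setting.** Let $d\ge 1$, $p\ge 1$ (real), and let $\mathcal P_p(\mathbb R^d)$ be the set of Borel probability measures on $\mathbb R^d$ with finite $p$-th moment. For $\theta$ in the unit sphere $\mathbb S^{d-1}$, $\theta\sharp\mu$ is the push-forward of $\mu$ under $x\mapsto\theta^\top x$, and $W_p^p(\alpha,\beta)=\inf_{\pi}\int|x-y|^p\,d\pi(x,y)$ over all couplings $\pi$ of the measures $\alpha,\beta$ on $\mathbb R$. Let $(\sigma_\kappa)_{0<\kappa<\infty}$ be a location-scale family on $\mathbb S^{d-1}$: the density of $\sigma_\kappa(\cdot\,;\epsilon)$ with respect to the surface measure is $\sigma_\kappa(\theta;\epsilon)\propto g_\kappa(\epsilon^\top\theta)$, where $g_\kappa$ is continuous on $[-1,1]$ and positive on $(-1,1]$; examples are the von Mises–Fisher family, $g_\kappa(t)=e^{\kappa t}$, and the power spherical family, $g_\kappa(t)=(1+t)^\kappa$. Let $P(z)=z/\|z\|_2$ for $z\ne 0$; the undefined value $P(0)$ is set to $c/\|c\|_2$ for an arbitrary fixed vector $c\neq0$, or to $0$ (in which case $\sigma_\kappa(\cdot\,;P(0))$ is the uniform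 distribution). Put $$\sigma_{RP}(\theta;\mu,\nu)=\iint\sigma_\kappa(\theta;P(x-y))\,d\mu(x)\,d\nu(y),$$ $$\mathrm{RPSW}_p(\mu,\nu)=\Big(\mathbb E_{\theta\sim\sigma_{RP}(\cdot;\mu,\nu)}\big[W_p^p(\theta\sharp\mu,\theta\sharp\nu)\big]\Big)^{1/p},$$ $$\mathrm{RPSW}_p(\mu,\nu;\mu',\nu')=\Big(\mathbb E_{\theta\sim\sigma_{RP}(\cdot;\mu',\nu')}\big[W_p^p(\theta\sharp\mu,\theta\sharp\nu)\big]\Big)^{1/p},$$ and, for an integer $L\ge1$ and a measurable $f:[0,\infty)\to(0,\infty)$, with $\theta_1,\dots,\theta_L$ i.i.d. of law $\sigma_{RP}(\cdot;\mu,\nu)$ and $w_l=W_p^p(\theta_l\sharp\mu,\theta_l\sharp\nu)$, $$\mathrm{IWRPSW}_p(\mu,\nu)=\Big(\mathbb E\Big[\sum_{l=1}^L w_l\,\frac{f(w_l)}{\sum_{j=1}^L f(w_j)}\Big]\Big)^{1/p}.$$ **Theorem.** For all such $d,p,L,f$, every such family $\sigma_\kappa$ and every $0<\kappa<\infty$: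 1. For all $\mu,\nu\in\mathcal P_p(\mathbb R^d)$, $\mathrm{RPSW}_p(\mu,\nu)$ and $\mathrm{IWRPSW}_p(\mu,\nu)$ are non-negative and finite, they are symmetric in $(\mu,\nu)$, and each of them vanishes if and only if $\mu=\nu$. 2. For all $x\ne y$ in $\mathbb R^d$ and all $\theta\in\mathbb S^{d-1}$, $\sigma_\kappa(\theta;P(x-y))=\sigma_\kappa(-\theta;P(y-x))$. 3. For all $\mu_1,\mu_2,\mu_3\in\mathcal P_p(\mathbb R^d)$, $$\mathrm{RPSW}_p(\mu_1,\mu_2)\le\mathrm{RPSW}_p(\mu_1,\mu_3;\mu_1,\mu_2)+\mathrm{RPSW}_p(\mu_3,\mu_2;\mu_1,\mu_2),$$ where both terms on the right are finite. -/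

import Mathlib

open MeasureTheory Set
open scoped ENNReal NNReal

noncomputable section

/-- Euclidean space `ℝ^d`. -/
abbrev RPSpace (d : ℕ) : Type := EuclideanSpace ℝ (Fin d)

/-- The unit sphere `S^{d-1}` of `ℝ^d`. -/
abbrev RPSphere (d : ℕ) : Type := Metric.sphere (0 : RPSpace d) 1

/-- The surface measure on `S^{d-1}` (for `d = 1` it gives mass one to each of the two points). -/
def surfaceMeasure (d : ℕ) : Measure (RPSphere d) := (volume : Measure (RPSpace d)).toSphere

/-- `μ ∈ P_p(ℝ^d)`: a probability measure with finite `p`-th moment. -/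
def IsPp {d : ℕ} (p : ℝ) (μ : Measure (RPSpace d)) : Prop :=
  IsProbabilityMeasure μ ∧ ∫⁻ x, ‖x‖ₑ ^ p ∂μ < ∞

/-- The couplings of two measures on the real line. -/
def couplings (α β : Measure ℝ) : Set (Measure (ℝ × ℝ)) :=
  {π | π.map Prod.fst = α ∧ π.map Prod.snd = β}

/-- `W_p^p(α, β) = inf over couplings π of ∫ |x - y|^p dπ(x, y)`. -/
def wassersteinPow (p : ℝ) (α β : Measure ℝ) : ℝ≥0∞ :=
  ⨅ π ∈ couplings α β, ∫⁻ z, ‖z.1 - z.2‖ₑ ^ p ∂π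

/-- `θ ♯ μ`: the push-forward of `μ` under `x ↦ θᵀ x`. -/
def project {d : ℕ} (θ : RPSphere d) (μ : Measure (RPSpace d)) : Measure ℝ :=
  μ.map (fun x => inner ℝ (θ : RPSpace d) x)

/-- A location-scale family `σ_κ(· ; ε)` on the unit sphere, with location `ε` and concentration
`κ ∈ (0, ∞)`: its density with respect to the surface measure is proportional to
`θ ↦ profile κ (εᵀ θ)`, where the profile is continuous on `[-1, 1]` and positive on `(-1, 1]`. -/
structure SphericalFamily where
  profile : ℝ → ℝ → ℝ
  continuousOn_profile : ∀ κ, 0 < κ → ContinuousOn (profile κ) (Icc (-1) 1)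
  profile_pos : ∀ κ, 0 < κ → ∀ t ∈ Ioc (-1 : ℝ) 1, 0 < profile κ t

/-- The von Mises-Fisher family, with density proportional to `exp (κ εᵀ θ)`. -/
def SphericalFamily.vMF : SphericalFamily where
  profile κ t := Real.exp (κ * t)
  continuousOn_profile κ _ := by fun_prop
  profile_pos κ _ t _ := Real.exp_pos _

/-- The power spherical family, with density proportional to `(1 + εᵀ θ) ^ κ`. -/
def SphericalFamily.PS : SphericalFamily where
  profile κ t := (1 + t) ^ κ
  continuousOn_profile κ hκ :=
    ContinuousOn.rpow_const (by fun_prop) (fun _ _ => Or.inr hκ.le)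
  profile_pos κ _ t ht := Real.rpow_pos_of_pos (by linarith [ht.1]) κ

/-- The normalized density `σ_κ(θ; ε)` with respect to the surface measure. For `ε = 0` it is the
uniform density. -/
def SphericalFamily.density {d : ℕ} (σ : SphericalFamily) (κ : ℝ) (ε : RPSpace d)
    (θ : RPSphere d) : ℝ≥0∞ :=
  ENNReal.ofReal (σ.profile κ (inner ℝ ε (θ : RPSpace d))) /
    ∫⁻ η : RPSphere d, ENNReal.ofReal (σ.profile κ (inner ℝ ε (η : RPSpace d))) ∂(surfaceMeasure d)

/-- The projection `P(z) = z / ‖z‖` on the unit sphere. At `z = 0`, where this is undefined, `z` is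
replaced by the constant `c`; for `c = 0` this gives the location `0`, hence the uniform density. -/
def sphereProj {d : ℕ} (c z : RPSpace d) : RPSpace d :=
  open Classical in if z = 0 then ‖c‖⁻¹ • c else ‖z‖⁻¹ • z

/-- The random-path slicing distribution on the sphere, given by its density
`θ ↦ ∫∫ σ_κ(θ; P(x - y)) dμ(x) dν(y)` with respect to the surface measure. -/
def rpsd {d : ℕ} (σ : SphericalFamily) (κ : ℝ) (c : RPSpace d) (μ ν : Measure (RPSpace d)) :
    Measure (RPSphere d) :=
  (surfaceMeasure d).withDensity
    (fun θ => ∫⁻ z, σ.density κ (sphereProj c (z.1 - z.2)) θ ∂(μ.prod ν))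

/-- `(E_{θ ∼ τ} [W_p^p(θ ♯ μ, θ ♯ ν)])^{1/p}` for a slicing distribution `τ`. -/
def slicedW {d : ℕ} (p : ℝ) (τ : Measure (RPSphere d)) (μ ν : Measure (RPSpace d)) : ℝ≥0∞ :=
  (∫⁻ θ, wassersteinPow p (project θ μ) (project θ ν) ∂τ) ^ (1 / p)

/-- The random-path projection sliced Wasserstein distance `RPSW_p(μ, ν; σ_κ)`. -/
def RPSW {d : ℕ} (p : ℝ) (σ : SphericalFamily) (κ : ℝ) (c : RPSpace d)
    (μ ν : Measure (RPSpace d)) : ℝ≥0∞ :=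
  slicedW p (rpsd σ κ c μ ν) μ ν

/-- `RPSW_p(μ, ν; σ_κ, μ', ν')`: the slicing distribution is the one of the pair `(μ', ν')`. -/
def RPSWWith {d : ℕ} (p : ℝ) (σ : SphericalFamily) (κ : ℝ) (c : RPSpace d)
    (μ ν μ' ν' : Measure (RPSpace d)) : ℝ≥0∞ :=
  slicedW p (rpsd σ κ c μ' ν') μ ν

/-- The importance weighted distance `IWRPSW_p(μ, ν; σ_κ, L, f)`; the directions
`θ_1, …, θ_L` are i.i.d. with the random-path slicing distribution as common law. -/
def IWRPSW {d : ℕ} (p : ℝ) (σ : SphericalFamily) (κ : ℝ) (c : RPSpace d) (L : ℕ) (f : ℝ≥0 → ℝ≥0)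
    (μ ν : Measure (RPSpace d)) : ℝ≥0∞ :=
  (∫⁻ θ : Fin L → RPSphere d,
    ∑ l, wassersteinPow p (project (θ l) μ) (project (θ l) ν) *
      ((f (wassersteinPow p (project (θ l) μ) (project (θ l) ν)).toNNReal /
        ∑ j, f (wassersteinPow p (project (θ j) μ) (project (θ j) ν)).toNNReal : ℝ≥0) : ℝ≥0∞)
    ∂(Measure.pi (fun _ : Fin L => rpsd σ κ c μ ν))) ^ (1 / p)

end

open ProbabilityTheory Filter Topology

/-! Everything rests on the cost `h θ = W_p^p(θ♯μ, θ♯ν)` being bounded, continuous and even on the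
sphere. Boundedness (`exists_slicedCost_le`) gives finiteness. For a fixed slicing law, the triangle
inequality of `W_p` on the line integrates to one for the sliced quantity by Minkowski.

Evenness gives symmetry: exchanging `μ` and `ν` turns `P(x - y)` into its negative off the diagonal
and leaves it alone on the diagonal, and an even function has the same integral against `σ_κ(·; ε)`
and `σ_κ(·; -ε)`. Hence the law of `h θ` is unchanged (`map_rpsd_comm_of_even`), which also settles
the weighted version.

If the distance vanishes, so does `h` almost surely, and `eq_zero_of_ae_rpsd_eq_zero` improves this
to every direction: `σ_κ(·; ε)` is positive except possibly at `-ε`. Then all projections of `μ` and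
`ν` agree, and Cramér–Wold concludes. -/

/-! ### The Wasserstein cost on the line -/

theorem exists_gluing {α γ β : Measure ℝ} [IsProbabilityMeasure γ] {π₁ π₂ : Measure (ℝ × ℝ)}
    (h₁ : π₁ ∈ couplings α γ) (h₂ : π₂ ∈ couplings γ β) :
    ∃ ρ : Measure (ℝ × ℝ × ℝ), ρ.map (fun z => (z.2.1, z.1)) = π₁ ∧
      ρ.map (fun z => (z.1, z.2.2)) = π₂ := by
  have hs : (π₁.map Prod.swap).fst = γ := by
    rw [Measure.fst_map_swap]; exact h₁.2
  have hf : π₂.fst = γ := h₂.1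
  have : IsFiniteMeasure (π₁.map Prod.swap) :=
    ⟨by rw [← Measure.fst_univ, hs]; exact measure_lt_top _ _⟩
  have : IsFiniteMeasure π₂ := ⟨by rw [← Measure.fst_univ, hf]; exact measure_lt_top _ _⟩
  set k₁ := (π₁.map Prod.swap).condKernel
  set k₂ := π₂.condKernel
  have e₁ : γ ⊗ₘ k₁ = π₁.map Prod.swap := by
    rw [← hs]; exact Measure.disintegrate _ _
  have e₂ : γ ⊗ₘ k₂ = π₂ := by
    rw [← hf]; exact Measure.disintegrate _ _
  -- The shared variable comes first; the other two are made conditionally independent given it.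
  refine ⟨γ ⊗ₘ (k₁ ×ₖ k₂), ?_, ?_⟩
  · have : k₁ = (k₁ ×ₖ k₂).map Prod.fst := by
      rw [← Kernel.fst_eq, Kernel.fst_prod]
    rw [this, Measure.compProd_map measurable_fst] at e₁
    have e := congrArg (Measure.map Prod.swap) e₁
    rw [Measure.map_map measurable_swap (by fun_prop),
      Measure.map_map measurable_swap (by fun_prop)] at e
    simpa [Function.comp_def, Prod.map] using e
  · have : k₂ = (k₁ ×ₖ k₂).map Prod.snd := by
      rw [← Kernel.snd_eq, Kernel.snd_prod]
    rw [this, Measure.compProd_map measurable_snd] at e₂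
    exact e₂

/-- The root is an order isomorphism of `[0, ∞]`, so it commutes with the infimum and no optimal
coupling is needed. -/
theorem wassersteinPow_rpow_inv {p : ℝ} (hp : 0 < p) (α β : Measure ℝ) :
    wassersteinPow p α β ^ (1 / p) =
      ⨅ π : couplings α β, (∫⁻ z, ‖z.1 - z.2‖ₑ ^ p ∂(π : Measure (ℝ × ℝ))) ^ (1 / p) := by
  rw [wassersteinPow, iInf_subtype']
  exact (ENNReal.orderIsoRpow (1 / p) (one_div_pos.2 hp)).map_iInf _

theorem wassersteinPow_rpow_inv_triangle {p : ℝ} (hp : 1 ≤ p) (α γ β : Measure ℝ)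
    [IsProbabilityMeasure γ] :
    wassersteinPow p α β ^ (1 / p) ≤
      wassersteinPow p α γ ^ (1 / p) + wassersteinPow p γ β ^ (1 / p) := by
  have hp0 : 0 < p := by linarith
  simp only [wassersteinPow_rpow_inv hp0]
  simp_rw [ENNReal.iInf_add, ENNReal.add_iInf]
  refine le_iInf fun π₁ => le_iInf fun π₂ => ?_
  obtain ⟨π₁, h₁⟩ := π₁
  obtain ⟨π₂, h₂⟩ := π₂
  obtain ⟨ρ, e₁, e₂⟩ := exists_gluing h₁ h₂
  have m₁ : Measurable fun z : ℝ × ℝ × ℝ => (z.2.1, z.1) := by fun_prop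
  have m₂ : Measurable fun z : ℝ × ℝ × ℝ => (z.1, z.2.2) := by fun_prop
  have m₃ : Measurable fun z : ℝ × ℝ × ℝ => (z.2.1, z.2.2) := by fun_prop
  have hc : Measurable fun z : ℝ × ℝ => ‖z.1 - z.2‖ₑ ^ p := by fun_prop
  have h₃ : ρ.map (fun z => (z.2.1, z.2.2)) ∈ couplings α β := by
    constructor
    · rw [Measure.map_map measurable_fst m₃, ← h₁.1, ← e₁, Measure.map_map measurable_fst m₁]
      rfl
    · rw [Measure.map_map measurable_snd m₃, ← h₂.2, ← e₂, Measure.map_map measurable_snd m₂]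
      rfl
  refine (iInf_le _ ⟨_, h₃⟩).trans ?_
  subst e₁ e₂
  simp only [lintegral_map hc m₁, lintegral_map hc m₂, lintegral_map hc m₃]
  refine le_trans ?_ (ENNReal.lintegral_Lp_add_le (μ := ρ)
    (f := fun z => ‖z.2.1 - z.1‖ₑ) (g := fun z => ‖z.1 - z.2.2‖ₑ)
    (by fun_prop) (by fun_prop) hp)
  gcongr with z
  simp only [Pi.add_apply]
  rw [← sub_add_sub_cancel z.2.1 z.1 z.2.2]
  exact enorm_add_le _ _

theorem wassersteinPow_le_lintegral {p : ℝ} {α β : Measure ℝ} {π : Measure (ℝ × ℝ)}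
    (hπ : π ∈ couplings α β) : wassersteinPow p α β ≤ ∫⁻ z, ‖z.1 - z.2‖ₑ ^ p ∂π :=
  iInf₂_le π hπ

theorem wassersteinPow_comm (p : ℝ) (α β : Measure ℝ) :
    wassersteinPow p α β = wassersteinPow p β α := by
  have key : ∀ α β : Measure ℝ, wassersteinPow p α β ≤ wassersteinPow p β α := by
    intro α β
    refine le_iInf₂ fun π hπ => ?_
    have hc : Measurable fun z : ℝ × ℝ => ‖z.1 - z.2‖ₑ ^ p := by fun_prop
    refine (wassersteinPow_le_lintegral (π := π.map Prod.swap) ⟨?_, ?_⟩).trans ?_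
    · rw [Measure.map_map measurable_fst measurable_swap]; exact hπ.2
    · rw [Measure.map_map measurable_snd measurable_swap]; exact hπ.1
    · rw [lintegral_map hc measurable_swap]
      simp [enorm_sub_rev]
  exact le_antisymm (key _ _) (key _ _)

theorem wassersteinPow_map_le {Ω : Type*} [MeasurableSpace Ω] (p : ℝ) (μ : Measure Ω)
    {f g : Ω → ℝ} (hf : Measurable f) (hg : Measurable g) :
    wassersteinPow p (μ.map f) (μ.map g) ≤ ∫⁻ ω, ‖f ω - g ω‖ₑ ^ p ∂μ := by
  have hc : Measurable fun z : ℝ × ℝ => ‖z.1 - z.2‖ₑ ^ p := by fun_prop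
  have hfg := hf.prodMk hg
  refine (wassersteinPow_le_lintegral (π := μ.map fun ω => (f ω, g ω)) ⟨?_, ?_⟩).trans ?_
  · rw [Measure.map_map measurable_fst hfg]; rfl
  · rw [Measure.map_map measurable_snd hfg]; rfl
  · rw [lintegral_map hc hfg]

theorem wassersteinPow_self {p : ℝ} (hp : 0 < p) (α : Measure ℝ) : wassersteinPow p α α = 0 := by
  have h := wassersteinPow_map_le p α measurable_id measurable_id
  simpa [ENNReal.zero_rpow_of_pos hp] using h

/-- Since `u ↦ exp (i t u)` is `|t|`-Lipschitz, any coupling bounds the difference by its `L¹` cost,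
hence by its `L^p` cost. This yields separation of measures without an optimal coupling. -/
theorem enorm_charFun_sub_le {p : ℝ} (hp : 1 ≤ p) {α β : Measure ℝ} [IsProbabilityMeasure α]
    {π : Measure (ℝ × ℝ)} (h : π ∈ couplings α β) (t : ℝ) :
    ‖charFun α t - charFun β t‖ₑ ≤ ‖t‖ₑ * (∫⁻ z, ‖z.1 - z.2‖ₑ ^ p ∂π) ^ (1 / p) := by
  have : IsProbabilityMeasure π := by
    constructor
    rw [← Measure.fst_univ, Measure.fst, h.1]; simp
  have hi : ∀ f : ℝ × ℝ → ℝ, Measurable f →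
      Integrable (fun z => Complex.exp (t * f z * Complex.I)) π := by
    intro f hf
    refine Integrable.of_bound (by fun_prop) 1 (ae_of_all _ fun z => ?_)
    rw [← Complex.ofReal_mul, Complex.norm_exp_ofReal_mul_I]
  have hα : charFun α t = ∫ z, Complex.exp (t * (z.1 : ℝ) * Complex.I) ∂π := by
    rw [charFun_apply_real, ← h.1, integral_map (by fun_prop) (by fun_prop)]
  have hβ : charFun β t = ∫ z, Complex.exp (t * (z.2 : ℝ) * Complex.I) ∂π := by
    rw [charFun_apply_real, ← h.2, integral_map (by fun_prop) (by fun_prop)]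
  rw [hα, hβ, ← integral_sub (hi _ measurable_fst) (hi _ measurable_snd)]
  refine (enorm_integral_le_lintegral_enorm _).trans ?_
  calc _ ≤ ∫⁻ z, ‖t‖ₑ * ‖z.1 - z.2‖ₑ ∂π := by
        refine lintegral_mono fun z => ?_
        have e : Complex.exp (t * (z.1 : ℝ) * Complex.I) - Complex.exp (t * (z.2 : ℝ) * Complex.I)
            = Complex.exp (((t * z.2 : ℝ) : ℂ) * Complex.I) *
              (Complex.exp (Complex.I * ((t * (z.1 - z.2) : ℝ) : ℂ)) - 1) := by
          rw [mul_sub, ← Complex.exp_add, mul_one]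
          push_cast
          ring_nf
        have e1 : ‖Complex.exp (((t * z.2 : ℝ) : ℂ) * Complex.I)‖ₑ = 1 := by
          rw [← ofReal_norm, Complex.norm_exp_ofReal_mul_I, ENNReal.ofReal_one]
        simp only
        rw [e, enorm_mul, e1, one_mul, ← enorm_mul]
        exact Real.enorm_exp_I_mul_ofReal_sub_one_le
    _ = ‖t‖ₑ * ∫⁻ z, ‖z.1 - z.2‖ₑ ∂π := lintegral_const_mul _ (by fun_prop)
    _ ≤ _ := by
        gcongr
        have := eLpNorm'_le_eLpNorm'_of_exponent_le (μ := π) (f := fun z : ℝ × ℝ => z.1 - z.2)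
          zero_lt_one hp (by fun_prop)
        simpa [eLpNorm'] using this

theorem eq_of_wassersteinPow_eq_zero {p : ℝ} (hp : 1 ≤ p) {α β : Measure ℝ}
    [IsProbabilityMeasure α] [IsProbabilityMeasure β] (h : wassersteinPow p α β = 0) : α = β := by
  have hp0 : 0 < p := by linarith
  refine Measure.ext_of_charFun (funext fun t => ?_)
  have h0 : wassersteinPow p α β ^ (1 / p) = 0 := by
    rw [h, ENNReal.zero_rpow_of_pos (one_div_pos.2 hp0)]
  -- At `t = 0` the factor `‖t‖ₑ` moves through the infimum only over a nonempty set, as `0 * ∞ =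
  -- 0`.
  have : Nonempty (couplings α β) :=
    ⟨⟨α.prod β, by simp [Measure.map_fst_prod], by simp [Measure.map_snd_prod]⟩⟩
  have : ‖charFun α t - charFun β t‖ₑ ≤ ‖t‖ₑ * wassersteinPow p α β ^ (1 / p) := by
    rw [wassersteinPow_rpow_inv hp0, ENNReal.mul_iInf (fun h => absurd h enorm_ne_top)]
    exact le_iInf fun π => enorm_charFun_sub_le hp π.2 t
  rw [h0, mul_zero, nonpos_iff_eq_zero, enorm_eq_zero, sub_eq_zero] at this
  exact this

/-! ### The cost as a function of the direction -/

section Sphere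

variable {d : ℕ}

/-- The `p`-th power cost `θ ↦ W_p^p(θ ♯ μ, θ ♯ ν)` as a function of the direction. -/
noncomputable def slicedCost (p : ℝ) (μ ν : Measure (RPSpace d)) (θ : RPSphere d) : ℝ≥0∞ :=
  wassersteinPow p (project θ μ) (project θ ν)

theorem measurable_inner_sphere (θ : RPSphere d) :
    Measurable fun x : RPSpace d => inner ℝ (θ : RPSpace d) x := by fun_prop

instance (θ : RPSphere d) (μ : Measure (RPSpace d)) [IsProbabilityMeasure μ] :
    IsProbabilityMeasure (project θ μ) :=
  Measure.isProbabilityMeasure_map (measurable_inner_sphere θ).aemeasurable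

theorem enorm_inner_sphere_le (θ : RPSphere d) (x : RPSpace d) :
    ‖inner ℝ (θ : RPSpace d) x‖ₑ ≤ ‖x‖ₑ := by
  rw [enorm_le_iff_norm_le]
  simpa using norm_inner_le_norm (𝕜 := ℝ) (θ : RPSpace d) x

/-- Couple the two projections through the same point `x` and apply Cauchy–Schwarz. -/
theorem wassersteinPow_project_project_le {p : ℝ} (hp : 0 < p) (μ : Measure (RPSpace d))
    (θ η : RPSphere d) :
    wassersteinPow p (project θ μ) (project η μ) ^ (1 / p) ≤
      (∫⁻ x, ‖x‖ₑ ^ p ∂μ) ^ (1 / p) * edist θ η := by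
  have h : wassersteinPow p (project θ μ) (project η μ) ≤
      (∫⁻ x, ‖x‖ₑ ^ p ∂μ) * edist θ η ^ p := by
    refine (wassersteinPow_map_le p μ (measurable_inner_sphere θ)
      (measurable_inner_sphere η)).trans ?_
    rw [← lintegral_mul_const _ (by fun_prop)]
    refine lintegral_mono fun x => ?_
    simp only
    rw [← ENNReal.mul_rpow_of_nonneg _ _ hp.le]
    gcongr
    rw [← inner_sub_left, Subtype.edist_eq, edist_eq_enorm_sub, mul_comm, ← enorm_norm x,
      ← enorm_norm ((θ : RPSpace d) - η), ← enorm_mul, enorm_le_iff_norm_le]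
    simpa using norm_inner_le_norm (𝕜 := ℝ) ((θ : RPSpace d) - η) x
  calc _ ≤ ((∫⁻ x, ‖x‖ₑ ^ p ∂μ) * edist θ η ^ p) ^ (1 / p) := by gcongr
    _ = _ := by
      rw [ENNReal.mul_rpow_of_nonneg _ _ (by positivity), one_div, ENNReal.rpow_rpow_inv hp.ne']

/-- Two triangle inequalities show that the `p`-th root is Lipschitz in the direction. -/
theorem continuous_slicedCost {p : ℝ} (hp : 1 ≤ p) {μ ν : Measure (RPSpace d)}
    (hμ : IsPp p μ) (hν : IsPp p ν) : Continuous (slicedCost p μ ν) := by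
  have hp0 : 0 < p := by linarith
  have := hμ.1
  have := hν.1
  have key : Continuous fun θ => slicedCost p μ ν θ ^ (1 / p) := by
    refine continuous_of_le_add_edist
      ((∫⁻ x, ‖x‖ₑ ^ p ∂μ) ^ (1 / p) + (∫⁻ x, ‖x‖ₑ ^ p ∂ν) ^ (1 / p)) ?_ fun θ η => ?_
    · exact ENNReal.add_ne_top.2 ⟨ENNReal.rpow_ne_top_of_nonneg (by positivity) hμ.2.ne,
        ENNReal.rpow_ne_top_of_nonneg (by positivity) hν.2.ne⟩
    · calc _ ≤ wassersteinPow p (project θ μ) (project η μ) ^ (1 / p) +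
            wassersteinPow p (project η μ) (project θ ν) ^ (1 / p) :=
            wassersteinPow_rpow_inv_triangle hp _ _ _
        _ ≤ wassersteinPow p (project θ μ) (project η μ) ^ (1 / p) +
            (wassersteinPow p (project η μ) (project η ν) ^ (1 / p) +
              wassersteinPow p (project η ν) (project θ ν) ^ (1 / p)) := by
            gcongr
            exact wassersteinPow_rpow_inv_triangle hp _ _ _
        _ ≤ (∫⁻ x, ‖x‖ₑ ^ p ∂μ) ^ (1 / p) * edist θ η +
            (slicedCost p μ ν η ^ (1 / p) + (∫⁻ x, ‖x‖ₑ ^ p ∂ν) ^ (1 / p) * edist θ η) := by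
            gcongr
            · exact wassersteinPow_project_project_le hp0 μ θ η
            · rfl
            · rw [edist_comm]
              exact wassersteinPow_project_project_le hp0 ν η θ
        _ = _ := by ring
  have e : slicedCost p μ ν = fun θ => (slicedCost p μ ν θ ^ (1 / p)) ^ p := by
    ext θ
    rw [one_div, ENNReal.rpow_inv_rpow hp0.ne']
  rw [e]
  exact ENNReal.continuous_rpow_const.comp key

theorem exists_slicedCost_le {p : ℝ} (hp : 1 ≤ p) {μ ν : Measure (RPSpace d)}
    (hμ : IsPp p μ) (hν : IsPp p ν) : ∃ C : ℝ≥0∞, C < ∞ ∧ ∀ θ, slicedCost p μ ν θ ≤ C := by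
  have hp0 : 0 < p := by linarith
  have := hμ.1
  have := hν.1
  -- The independent coupling in `ℝ^d` projects to a coupling in every direction, at no greater
  -- cost.
  refine ⟨∫⁻ z, ‖z.1 - z.2‖ₑ ^ p ∂(μ.prod ν), ?_, fun θ => ?_⟩
  · calc _ ≤ ∫⁻ z, (2 : ℝ≥0∞) ^ (p - 1) * (‖z.1‖ₑ ^ p + ‖z.2‖ₑ ^ p) ∂(μ.prod ν) := by
          refine lintegral_mono fun z => ?_
          refine le_trans ?_ (ENNReal.rpow_add_le_mul_rpow_add_rpow _ _ hp)
          gcongr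
          exact enorm_sub_le
      _ = (2 : ℝ≥0∞) ^ (p - 1) * (∫⁻ x, ‖x‖ₑ ^ p ∂μ + ∫⁻ x, ‖x‖ₑ ^ p ∂ν) := by
          have h₁ : ∫⁻ z, ‖z.1‖ₑ ^ p ∂(μ.prod ν) = ∫⁻ x, ‖x‖ₑ ^ p ∂μ :=
            measurePreserving_fst.lintegral_comp (f := fun x => ‖x‖ₑ ^ p) (by fun_prop)
          have h₂ : ∫⁻ z, ‖z.2‖ₑ ^ p ∂(μ.prod ν) = ∫⁻ x, ‖x‖ₑ ^ p ∂ν :=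
            measurePreserving_snd.lintegral_comp (f := fun x => ‖x‖ₑ ^ p) (by fun_prop)
          rw [lintegral_const_mul _ (by fun_prop), lintegral_add_left (by fun_prop), h₁, h₂]
      _ < ∞ := ENNReal.mul_lt_top
          (ENNReal.rpow_lt_top_of_nonneg (by linarith) ENNReal.ofNat_ne_top)
          (ENNReal.add_lt_top.2 ⟨hμ.2, hν.2⟩)
  · have e₁ : project θ μ = (μ.prod ν).map fun z => inner ℝ (θ : RPSpace d) z.1 := by
      rw [project, ← (measurePreserving_fst (μ := μ) (ν := ν)).map_eq,
        Measure.map_map (measurable_inner_sphere θ) measurable_fst]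
      simp [Function.comp_def, Measure.map_fst_prod]
    have e₂ : project θ ν = (μ.prod ν).map fun z => inner ℝ (θ : RPSpace d) z.2 := by
      rw [project, ← (measurePreserving_snd (μ := μ) (ν := ν)).map_eq,
        Measure.map_map (measurable_inner_sphere θ) measurable_snd]
      simp [Function.comp_def, Measure.map_snd_prod]
    rw [slicedCost, e₁, e₂]
    refine (wassersteinPow_map_le p _ (by fun_prop) (by fun_prop)).trans ?_
    gcongr with z
    rw [← inner_sub_right]
    exact enorm_inner_sphere_le θ _

theorem slicedCost_comm (p : ℝ) (μ ν : Measure (RPSpace d)) :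
    slicedCost p μ ν = slicedCost p ν μ :=
  funext fun _ => wassersteinPow_comm _ _ _

theorem project_neg (θ : RPSphere d) (μ : Measure (RPSpace d)) :
    project (-θ) μ = (project θ μ).map Neg.neg := by
  rw [project, project, Measure.map_map measurable_neg (measurable_inner_sphere θ)]
  congr 1
  ext x
  simp

theorem wassersteinPow_map_neg_le (p : ℝ) (α β : Measure ℝ) :
    wassersteinPow p (α.map Neg.neg) (β.map Neg.neg) ≤ wassersteinPow p α β := by
  refine le_iInf₂ fun π hπ => ?_
  have hm : Measurable fun z : ℝ × ℝ => (-z.1, -z.2) := by fun_prop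
  refine (wassersteinPow_le_lintegral (π := π.map fun z => (-z.1, -z.2)) ⟨?_, ?_⟩).trans ?_
  · rw [Measure.map_map measurable_fst hm, ← hπ.1, Measure.map_map measurable_neg measurable_fst]
    rfl
  · rw [Measure.map_map measurable_snd hm, ← hπ.2, Measure.map_map measurable_neg measurable_snd]
    rfl
  · rw [lintegral_map (by fun_prop) hm]
    refine lintegral_mono fun z => ?_
    simp only
    rw [← neg_sub', enorm_neg]

theorem slicedCost_neg (p : ℝ) (μ ν : Measure (RPSpace d)) (θ : RPSphere d) :
    slicedCost p μ ν (-θ) = slicedCost p μ ν θ := by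
  have key : ∀ η : RPSphere d, slicedCost p μ ν (-η) ≤ slicedCost p μ ν η := fun η => by
    rw [slicedCost, project_neg, project_neg]
    exact wassersteinPow_map_neg_le _ _ _
  exact le_antisymm (key θ) (by simpa using key (-θ))

theorem slicedCost_self {p : ℝ} (hp : 0 < p) (μ : Measure (RPSpace d)) (θ : RPSphere d) :
    slicedCost p μ μ θ = 0 :=
  wassersteinPow_self hp _

/-- The Cramér–Wold theorem: a law is determined by its one-dimensional projections. -/
theorem eq_of_project_eq {μ ν : Measure (RPSpace d)} [IsProbabilityMeasure μ]
    [IsProbabilityMeasure ν] (h : ∀ θ : RPSphere d, project θ μ = project θ ν) : μ = ν := by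
  refine Measure.ext_of_charFun (funext fun t => ?_)
  rcases eq_or_ne t 0 with rfl | ht
  · simp
  have ht' : ‖t‖ ≠ 0 := norm_ne_zero_iff.2 ht
  let θ : RPSphere d := ⟨‖t‖⁻¹ • t, by simp [norm_smul, ht']⟩
  have key : ∀ ρ : Measure (RPSpace d), charFun ρ t = charFun (project θ ρ) ‖t‖ := fun ρ => by
    rw [project, charFun_apply_real,
      integral_map (measurable_inner_sphere θ).aemeasurable (by fun_prop), charFun_apply]
    congr 1
    ext x
    rw [← Complex.ofReal_mul]
    congr 3
    simp only [θ, inner_smul_left, real_inner_comm]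
    simp [ht']
  rw [key μ, key ν, h θ]

theorem eq_of_slicedCost_eq_zero {p : ℝ} (hp : 1 ≤ p) {μ ν : Measure (RPSpace d)}
    [IsProbabilityMeasure μ] [IsProbabilityMeasure ν] (h : ∀ θ, slicedCost p μ ν θ = 0) : μ = ν :=
  eq_of_project_eq fun θ => eq_of_wassersteinPow_eq_zero hp (h θ)

/-! ### Surface measure and locations -/

instance : IsFiniteMeasure (surfaceMeasure d) := by
  unfold surfaceMeasure; infer_instance

instance : (surfaceMeasure d).IsOpenPosMeasure := by
  unfold surfaceMeasure; infer_instance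

/-- The surface measure is a multiple of the volume of the cone over a set, and Lebesgue measure is
invariant under negation. -/
theorem measurePreserving_neg_surfaceMeasure :
    MeasurePreserving (Neg.neg : RPSphere d → RPSphere d) (surfaceMeasure d) (surfaceMeasure d) := by
  refine ⟨continuous_neg.measurable, Measure.ext fun s hs => ?_⟩
  rw [Measure.map_apply continuous_neg.measurable hs, surfaceMeasure,
    Measure.toSphere_apply' _ (continuous_neg.measurable hs), Measure.toSphere_apply' _ hs]
  congr 1
  rw [← Measure.measure_preimage_neg]
  congr 1
  ext x
  simp only [Set.mem_preimage, Set.mem_smul, Set.mem_image]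
  constructor
  · rintro ⟨r, hr, _, ⟨y, hy, rfl⟩, h⟩
    exact ⟨r, hr, _, ⟨-y, hy, rfl⟩, by simp [h]⟩
  · rintro ⟨r, hr, _, ⟨y, hy, rfl⟩, h⟩
    exact ⟨r, hr, _, ⟨-y, by simpa using hy, rfl⟩, by simp [h]⟩

theorem lintegral_neg_surfaceMeasure (h : RPSphere d → ℝ≥0∞) :
    ∫⁻ θ, h (-θ) ∂(surfaceMeasure d) = ∫⁻ θ, h θ ∂(surfaceMeasure d) :=
  measurePreserving_neg_surfaceMeasure.lintegral_comp_emb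
    (Homeomorph.neg (RPSphere d)).measurableEmbedding h

theorem norm_sphereProj_le (c z : RPSpace d) : ‖sphereProj c z‖ ≤ 1 := by
  have key : ∀ w : RPSpace d, ‖‖w‖⁻¹ • w‖ ≤ 1 := fun w => by
    rw [norm_smul, norm_inv, norm_norm]
    exact inv_mul_le_one
  unfold sphereProj
  split_ifs
  exacts [key c, key z]

theorem sphereProj_neg {c z : RPSpace d} (hz : z ≠ 0) : sphereProj c (-z) = -sphereProj c z := by
  simp [sphereProj, hz]

theorem measurable_sphereProj (c : RPSpace d) : Measurable (sphereProj c) := by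
  unfold sphereProj
  exact Measurable.ite (measurableSet_singleton 0) measurable_const (by fun_prop)

theorem inner_mem_Icc {ε : RPSpace d} (hε : ‖ε‖ ≤ 1) (θ : RPSphere d) :
    inner ℝ ε (θ : RPSpace d) ∈ Icc (-1 : ℝ) 1 := by
  have := abs_real_inner_le_norm ε (θ : RPSpace d)
  rw [norm_eq_of_mem_sphere, mul_one] at this
  exact abs_le.1 (this.trans hε)

/-- At inner product `-1`, `‖θ + ε‖² = ‖ε‖² - 1 ≤ 0`. The location `0` is covered too. -/
theorem neg_one_lt_inner {ε : RPSpace d} (hε : ‖ε‖ ≤ 1) {θ : RPSphere d}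
    (h : (θ : RPSpace d) ≠ -ε) : -1 < inner ℝ ε (θ : RPSpace d) := by
  refine lt_of_le_of_ne (inner_mem_Icc hε θ).1 fun e => h ?_
  have h1 : ‖(θ : RPSpace d) + ε‖ ^ 2 ≤ 0 := by
    rw [norm_add_sq_real, norm_eq_of_mem_sphere, real_inner_comm, ← e]
    nlinarith [norm_nonneg ε]
  have h2 : ‖(θ : RPSpace d) + ε‖ = 0 := by
    nlinarith [norm_nonneg ((θ : RPSpace d) + ε)]
  exact eq_neg_of_add_eq_zero_left (norm_eq_zero.1 h2)

/-! ### Location-scale densities -/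

namespace SphericalFamily

variable (σ : SphericalFamily) {κ : ℝ}

/-- The profile, extended from `[-1, 1]` to a continuous function on the line. -/
noncomputable def extendedProfile (κ t : ℝ) : ℝ :=
  IccExtend (by norm_num : (-1 : ℝ) ≤ 1) ((Icc (-1 : ℝ) 1).domRestrict (σ.profile κ)) t

theorem continuous_extendedProfile (hκ : 0 < κ) : Continuous (σ.extendedProfile κ) :=
  (continuousOn_iff_continuous_domRestrict.1 (σ.continuousOn_profile κ hκ)).Icc_extend'

/-- The profile is arbitrary off `[-1, 1]`; measurability is obtained from its continuous extension.
-/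
theorem profile_inner {ε : RPSpace d} (hε : ‖ε‖ ≤ 1) (θ : RPSphere d) :
    σ.profile κ (inner ℝ ε (θ : RPSpace d)) =
      σ.extendedProfile κ (inner ℝ ε (θ : RPSpace d)) := by
  rw [extendedProfile, IccExtend_of_mem _ _ (inner_mem_Icc hε θ)]
  rfl

theorem density_eq {ε : RPSpace d} (hε : ‖ε‖ ≤ 1) (θ : RPSphere d) :
    σ.density κ ε θ = ENNReal.ofReal (σ.extendedProfile κ (inner ℝ ε (θ : RPSpace d))) /
      ∫⁻ η : RPSphere d, ENNReal.ofReal (σ.extendedProfile κ (inner ℝ ε (η : RPSpace d)))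
        ∂(surfaceMeasure d) := by
  simp only [density, σ.profile_inner hε]

theorem measurable_lintegral_extendedProfile (hκ : 0 < κ) :
    Measurable fun ε : RPSpace d => ∫⁻ η : RPSphere d,
      ENNReal.ofReal (σ.extendedProfile κ (inner ℝ ε (η : RPSpace d))) ∂(surfaceMeasure d) := by
  have hm : Measurable fun q : RPSpace d × RPSphere d => ENNReal.ofReal
      (σ.extendedProfile κ (inner ℝ q.1 (q.2 : RPSpace d))) :=
    ENNReal.measurable_ofReal.comp ((σ.continuous_extendedProfile hκ).measurable.comp
      (measurable_fst.inner (measurable_subtype_coe.comp measurable_snd)))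
  exact hm.lintegral_prod_right'

theorem measurable_density (hκ : 0 < κ) (c : RPSpace d) {Ω : Type*} [MeasurableSpace Ω]
    {u : Ω → RPSpace d} {v : Ω → RPSphere d} (hu : Measurable u) (hv : Measurable v) :
    Measurable fun ω => σ.density κ (sphereProj c (u ω)) (v ω) := by
  have hs : Measurable fun ω => sphereProj c (u ω) := (measurable_sphereProj c).comp hu
  simp only [σ.density_eq (norm_sphereProj_le c _)]
  exact (ENNReal.measurable_ofReal.comp ((σ.continuous_extendedProfile hκ).measurable.comp
    (hs.inner (measurable_subtype_coe.comp hv)))).div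
      ((σ.measurable_lintegral_extendedProfile hκ).comp hs)

theorem lintegral_profile_ne_top (hκ : 0 < κ) {ε : RPSpace d} (hε : ‖ε‖ ≤ 1) :
    ∫⁻ η : RPSphere d, ENNReal.ofReal (σ.profile κ (inner ℝ ε (η : RPSpace d)))
      ∂(surfaceMeasure d) ≠ ∞ := by
  obtain ⟨C, hC⟩ := isCompact_Icc.bddAbove_image (σ.continuousOn_profile κ hκ)
  refine ne_top_of_le_ne_top (b := ENNReal.ofReal C * surfaceMeasure d univ)
    (ENNReal.mul_ne_top ENNReal.ofReal_ne_top (measure_ne_top _ _)) ?_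
  rw [← lintegral_const]
  exact lintegral_mono fun η => ENNReal.ofReal_le_ofReal
    (hC (mem_image_of_mem _ (inner_mem_Icc hε η)))

theorem density_pos (hκ : 0 < κ) {ε : RPSpace d} (hε : ‖ε‖ ≤ 1) {θ : RPSphere d}
    (h : (θ : RPSpace d) ≠ -ε) : 0 < σ.density κ ε θ :=
  ENNReal.div_pos (ENNReal.ofReal_pos.2 (σ.profile_pos κ hκ _
    ⟨neg_one_lt_inner hε h, (inner_mem_Icc hε θ).2⟩)).ne' (σ.lintegral_profile_ne_top hκ hε)

theorem lintegral_profile_ne_zero (hd : 1 ≤ d) (hκ : 0 < κ) {ε : RPSpace d} (hε : ‖ε‖ ≤ 1) :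
    ∫⁻ η : RPSphere d, ENNReal.ofReal (σ.profile κ (inner ℝ ε (η : RPSpace d)))
      ∂(surfaceMeasure d) ≠ 0 := by
  simp only [σ.profile_inner hε]
  have hc : Continuous fun η : RPSphere d =>
      ENNReal.ofReal (σ.extendedProfile κ (inner ℝ ε (η : RPSpace d))) :=
    ENNReal.continuous_ofReal.comp ((σ.continuous_extendedProfile hκ).comp (by fun_prop))
  obtain ⟨η, hη⟩ : ∃ η : RPSphere d, (η : RPSpace d) ≠ -ε := by
    have : Nonempty (Fin d) := ⟨⟨0, hd⟩⟩
    obtain ⟨η⟩ : Nonempty (RPSphere d) := (NormedSpace.sphere_nonempty.2 zero_le_one).to_subtype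
    -- A point and its antipode cannot both equal `-ε`.
    by_contra! hall
    have h1 := hall η
    have h2 := hall (-η)
    exact ne_neg_of_mem_unit_sphere ℝ η (Subtype.ext (h1.trans h2.symm))
  intro h0
  have hz := (lintegral_eq_zero_iff hc.measurable).1 h0
  have hz := (hc.ae_eq_iff_eq (surfaceMeasure d) continuous_const).1 hz
  have hz := congrFun hz η
  have := σ.profile_pos κ hκ _ ⟨neg_one_lt_inner hε hη, (inner_mem_Icc hε η).2⟩
  rw [σ.profile_inner hε] at this
  exact absurd (ENNReal.ofReal_eq_zero.1 hz) this.not_ge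

theorem lintegral_density (hd : 1 ≤ d) (hκ : 0 < κ) {ε : RPSpace d} (hε : ‖ε‖ ≤ 1) :
    ∫⁻ θ, σ.density κ ε θ ∂(surfaceMeasure d) = 1 := by
  have h0 := σ.lintegral_profile_ne_zero hd hκ hε
  simp only [density, div_eq_mul_inv]
  rw [lintegral_mul_const' _ _ (ENNReal.inv_ne_top.2 h0)]
  exact ENNReal.mul_inv_cancel h0 (σ.lintegral_profile_ne_top hκ hε)

theorem density_neg_neg (ε : RPSpace d) (θ : RPSphere d) :
    σ.density κ (-ε) (-θ) = σ.density κ ε θ := by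
  unfold density
  congr 1
  · simp
  · rw [← lintegral_neg_surfaceMeasure]
    simp

end SphericalFamily

/-! ### The random-path slicing law -/

section Slicing

variable (σ : SphericalFamily) {κ : ℝ} (c : RPSpace d) (μ ν : Measure (RPSpace d))

theorem lintegral_rpsd [SFinite μ] [SFinite ν] (hκ : 0 < κ) {h : RPSphere d → ℝ≥0∞}
    (hh : Measurable h) :
    ∫⁻ θ, h θ ∂(rpsd σ κ c μ ν) = ∫⁻ z, ∫⁻ θ, σ.density κ (sphereProj c (z.1 - z.2)) θ * h θ
      ∂(surfaceMeasure d) ∂(μ.prod ν) := by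
  have hm : Measurable fun q : RPSphere d × (RPSpace d × RPSpace d) =>
      σ.density κ (sphereProj c (q.2.1 - q.2.2)) q.1 :=
    σ.measurable_density hκ c (by fun_prop) measurable_fst
  rw [rpsd, lintegral_withDensity_eq_lintegral_mul _ hm.lintegral_prod_right' hh]
  have : ∀ θ, ((fun θ => ∫⁻ z, σ.density κ (sphereProj c (z.1 - z.2)) θ ∂(μ.prod ν)) * h) θ =
      ∫⁻ z, σ.density κ (sphereProj c (z.1 - z.2)) θ * h θ ∂(μ.prod ν) := fun θ => by
    have hm' : Measurable fun z : RPSpace d × RPSpace d =>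
        σ.density κ (sphereProj c (z.1 - z.2)) θ :=
      σ.measurable_density hκ c (by fun_prop) measurable_const
    rw [Pi.mul_apply, lintegral_mul_const _ hm']
  rw [lintegral_congr this]
  exact lintegral_lintegral_swap (hm.mul (hh.comp measurable_fst)).aemeasurable

theorem isProbabilityMeasure_rpsd [IsProbabilityMeasure μ] [IsProbabilityMeasure ν]
    (hd : 1 ≤ d) (hκ : 0 < κ) : IsProbabilityMeasure (rpsd σ κ c μ ν) := by
  constructor
  rw [← lintegral_one, lintegral_rpsd σ c μ ν hκ measurable_const]
  simp [σ.lintegral_density hd hκ (norm_sphereProj_le c _)]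

/-- Evenness is essential: the diagonal `x = y` may carry mass, and its location `P(0)` is not
reflected by the exchange. -/
theorem lintegral_rpsd_comm_of_even [SFinite μ] [SFinite ν] (hκ : 0 < κ)
    {h : RPSphere d → ℝ≥0∞} (hh : Measurable h) (heven : ∀ θ, h (-θ) = h θ) :
    ∫⁻ θ, h θ ∂(rpsd σ κ c μ ν) = ∫⁻ θ, h θ ∂(rpsd σ κ c ν μ) := by
  rw [lintegral_rpsd σ c μ ν hκ hh, lintegral_rpsd σ c ν μ hκ hh]
  have hm : Measurable fun z : RPSpace d × RPSpace d =>
      ∫⁻ θ, σ.density κ (sphereProj c (z.1 - z.2)) θ * h θ ∂(surfaceMeasure d) :=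
    Measurable.lintegral_prod_right' (f := fun q : (RPSpace d × RPSpace d) × RPSphere d =>
      σ.density κ (sphereProj c (q.1.1 - q.1.2)) q.2 * h q.2)
      ((σ.measurable_density hκ c (by fun_prop) measurable_snd).mul (hh.comp measurable_snd))
  rw [← Measure.prod_swap, lintegral_map hm measurable_swap]
  refine lintegral_congr fun z => ?_
  rcases eq_or_ne z.2 z.1 with e | e
  · simp [e]
  · rw [← lintegral_neg_surfaceMeasure]
    refine lintegral_congr fun θ => ?_
    rw [heven, Prod.fst_swap, Prod.snd_swap, ← neg_sub z.1 z.2,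
      sphereProj_neg (sub_ne_zero.2 e.symm), σ.density_neg_neg]

theorem map_rpsd_comm_of_even [SFinite μ] [SFinite ν] (hκ : 0 < κ) {X : Type*} [MeasurableSpace X]
    {h : RPSphere d → X} (hh : Measurable h) (heven : ∀ θ, h (-θ) = h θ) :
    (rpsd σ κ c μ ν).map h = (rpsd σ κ c ν μ).map h := by
  refine Measure.ext fun s hs => ?_
  have e : ∀ τ : Measure (RPSphere d), τ.map h s = ∫⁻ θ, s.indicator 1 (h θ) ∂τ := fun τ => by
    rw [← lintegral_map (measurable_one.indicator hs) hh, lintegral_indicator_one hs]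
  rw [e, e]
  exact lintegral_rpsd_comm_of_even σ c μ ν hκ ((measurable_one.indicator hs).comp hh)
    fun θ => by rw [heven]

theorem eq_zero_of_ae_rpsd_eq_zero [IsProbabilityMeasure μ] [IsProbabilityMeasure ν]
    (hκ : 0 < κ) {h : RPSphere d → ℝ≥0∞} (hh : Continuous h) (heven : ∀ θ, h (-θ) = h θ)
    (h0 : ∀ᵐ θ ∂(rpsd σ κ c μ ν), h θ = 0) (θ : RPSphere d) : h θ = 0 := by
  have hi : ∫⁻ θ, h θ ∂(rpsd σ κ c μ ν) = 0 := (lintegral_eq_zero_iff hh.measurable).2 h0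
  have hm : Measurable fun q : (RPSpace d × RPSpace d) × RPSphere d =>
      σ.density κ (sphereProj c (q.1.1 - q.1.2)) q.2 * h q.2 :=
    (σ.measurable_density hκ c (by fun_prop) measurable_snd).mul (hh.measurable.comp measurable_snd)
  rw [lintegral_rpsd σ c μ ν hκ hh.measurable, lintegral_eq_zero_iff hm.lintegral_prod_right'] at hi
  -- A single pair of points already gives a density positive off one antipode.
  obtain ⟨z, hz⟩ := hi.exists
  have hm' : Measurable fun θ => σ.density κ (sphereProj c (z.1 - z.2)) θ * h θ :=
    (σ.measurable_density hκ c measurable_const measurable_id).mul hh.measurable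
  replace hz := (lintegral_eq_zero_iff hm').1 hz
  set ε := sphereProj c (z.1 - z.2)
  have hε : ‖ε‖ ≤ 1 := norm_sphereProj_le c _
  have hopen : IsOpen {η : RPSphere d | (η : RPSpace d) ≠ -ε ∧ h η ≠ 0} :=
    (isOpen_ne_fun continuous_subtype_val continuous_const).inter
      (isOpen_ne_fun hh continuous_const)
  have hempty : {η : RPSphere d | (η : RPSpace d) ≠ -ε ∧ h η ≠ 0} = ∅ := by
    refine hopen.eq_empty_of_measure_zero (measure_mono_null ?_ (ae_iff.1 hz))
    intro η hη
    exact mul_ne_zero (σ.density_pos hκ hε hη.1).ne' hη.2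
  have key : ∀ η : RPSphere d, (η : RPSpace d) ≠ -ε → h η = 0 := fun η hη => by
    by_contra hne
    exact (Set.eq_empty_iff_forall_notMem.1 hempty η) ⟨hη, hne⟩
  -- For `d = 1` the point `-ε` can be isolated, so continuity alone does not reach it; evenness
  -- does.
  by_cases hθ : (θ : RPSpace d) = -ε
  · rw [← heven]
    refine key _ fun h' => ?_
    rw [← hθ] at h'
    exact ne_neg_of_mem_unit_sphere ℝ θ (Subtype.ext h'.symm)
  · exact key θ hθ

end Slicing

end Sphere

/-! ### Importance weights -/

section ImportanceWeighting

variable {L : ℕ} {f : ℝ≥0 → ℝ≥0}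

/-- The importance weighted average of the costs `w_1, …, w_L`. -/
noncomputable def weightedCost (f : ℝ≥0 → ℝ≥0) (w : Fin L → ℝ≥0∞) : ℝ≥0∞ :=
  ∑ l, w l * ((f (w l).toNNReal / ∑ j, f (w j).toNNReal : ℝ≥0) : ℝ≥0∞)

theorem measurable_weightedCost (hf : Measurable f) :
    Measurable (weightedCost f : (Fin L → ℝ≥0∞) → ℝ≥0∞) := by
  unfold weightedCost
  fun_prop

theorem weightedCost_le {C : ℝ≥0∞} {w : Fin L → ℝ≥0∞} (hw : ∀ l, w l ≤ C) :
    weightedCost f w ≤ L * C := by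
  calc weightedCost f w ≤ ∑ _l : Fin L, C * 1 := by
        refine Finset.sum_le_sum fun l _ => mul_le_mul' (hw l) ?_
        exact_mod_cast div_le_one_of_le₀
          (Finset.single_le_sum (f := fun j => f (w j).toNNReal) (fun _ _ => zero_le)
            (Finset.mem_univ l)) zero_le
    _ = L * C := by simp

theorem eq_zero_of_weightedCost_eq_zero (hfpos : ∀ t, 0 < f t) {w : Fin L → ℝ≥0∞}
    (h : weightedCost f w = 0) (l : Fin L) : w l = 0 := by
  have h := (Finset.sum_eq_zero_iff.1 h) l (Finset.mem_univ l)
  refine (mul_eq_zero.1 h).resolve_right fun h' => ?_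
  have hsum : 0 < ∑ j, f (w j).toNNReal :=
    Finset.sum_pos (fun _ _ => hfpos _) ⟨l, Finset.mem_univ l⟩
  exact (div_pos (hfpos (w l).toNNReal) hsum).ne' (by exact_mod_cast h')

end ImportanceWeighting

/-! ### The two distances -/

section Distances

variable {d : ℕ} {p : ℝ} (σ : SphericalFamily) {κ : ℝ} (c : RPSpace d)
  {μ ν : Measure (RPSpace d)}

theorem slicedW_eq (τ : Measure (RPSphere d)) :
    slicedW p τ μ ν = (∫⁻ θ, slicedCost p μ ν θ ∂τ) ^ (1 / p) := rfl

theorem slicedW_lt_top (hp : 1 ≤ p) (τ : Measure (RPSphere d)) [IsFiniteMeasure τ]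
    (hμ : IsPp p μ) (hν : IsPp p ν) : slicedW p τ μ ν < ∞ := by
  obtain ⟨C, hC, hle⟩ := exists_slicedCost_le hp hμ hν
  refine ENNReal.rpow_lt_top_of_nonneg (by positivity) (ne_top_of_le_ne_top
    (ENNReal.mul_ne_top hC.ne (measure_ne_top τ univ)) ?_)
  rw [← lintegral_const]
  exact lintegral_mono hle

theorem slicedW_triangle (hp : 1 ≤ p) (τ : Measure (RPSphere d)) {μ₁ μ₂ μ₃ : Measure (RPSpace d)}
    (h₁ : IsPp p μ₁) (h₂ : IsPp p μ₂) (h₃ : IsPp p μ₃) :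
    slicedW p τ μ₁ μ₂ ≤ slicedW p τ μ₁ μ₃ + slicedW p τ μ₃ μ₂ := by
  have hp0 : 0 < p := by linarith
  have := h₃.1
  have e : ∀ μ ν : Measure (RPSpace d), slicedW p τ μ ν =
      (∫⁻ θ, (slicedCost p μ ν θ ^ (1 / p)) ^ p ∂τ) ^ (1 / p) := fun μ ν => by
    simp only [slicedW_eq, one_div, ENNReal.rpow_inv_rpow hp0.ne']
  rw [e, e, e]
  refine le_trans ?_ (ENNReal.lintegral_Lp_add_le (μ := τ)
    ((continuous_slicedCost hp h₁ h₃).measurable.pow_const _).aemeasurable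
    ((continuous_slicedCost hp h₃ h₂).measurable.pow_const _).aemeasurable hp)
  gcongr with θ
  exact wassersteinPow_rpow_inv_triangle hp _ _ _

theorem RPSW_comm (hp : 1 ≤ p) (hκ : 0 < κ) (hμ : IsPp p μ) (hν : IsPp p ν) :
    RPSW p σ κ c μ ν = RPSW p σ κ c ν μ := by
  have := hμ.1
  have := hν.1
  rw [RPSW, RPSW, slicedW_eq, slicedW_eq, slicedCost_comm p ν μ,
    lintegral_rpsd_comm_of_even σ c μ ν hκ (continuous_slicedCost hp hμ hν).measurable
      (slicedCost_neg p μ ν)]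

theorem RPSW_eq_zero_iff (hp : 1 ≤ p) (hκ : 0 < κ) (hμ : IsPp p μ) (hν : IsPp p ν) :
    RPSW p σ κ c μ ν = 0 ↔ μ = ν := by
  have hp0 : 0 < p := by linarith
  have := hμ.1
  have := hν.1
  have hc := continuous_slicedCost hp hμ hν
  rw [RPSW, slicedW_eq, ENNReal.rpow_eq_zero_iff_of_pos (one_div_pos.2 hp0)]
  constructor
  · intro h
    exact eq_of_slicedCost_eq_zero hp (eq_zero_of_ae_rpsd_eq_zero σ c μ ν hκ hc
      (slicedCost_neg p μ ν) ((lintegral_eq_zero_iff hc.measurable).1 h))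
  · rintro rfl
    simp [slicedCost_self hp0]

variable {L : ℕ} {f : ℝ≥0 → ℝ≥0}

theorem IWRPSW_eq : IWRPSW p σ κ c L f μ ν =
    (∫⁻ θ : Fin L → RPSphere d, weightedCost f (fun l => slicedCost p μ ν (θ l))
      ∂(Measure.pi fun _ => rpsd σ κ c μ ν)) ^ (1 / p) := rfl

theorem IWRPSW_lt_top (hd : 1 ≤ d) (hp : 1 ≤ p) (hκ : 0 < κ) (hμ : IsPp p μ) (hν : IsPp p ν) :
    IWRPSW p σ κ c L f μ ν < ∞ := by
  have := hμ.1
  have := hν.1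
  have := isProbabilityMeasure_rpsd σ c μ ν hd hκ
  obtain ⟨C, hC, hle⟩ := exists_slicedCost_le hp hμ hν
  refine ENNReal.rpow_lt_top_of_nonneg (by positivity) (ne_top_of_le_ne_top
    (ENNReal.mul_ne_top (ENNReal.natCast_ne_top L) hC.ne) ?_)
  calc _ ≤ ∫⁻ _ : Fin L → RPSphere d, L * C ∂(Measure.pi fun _ => rpsd σ κ c μ ν) :=
        lintegral_mono fun θ => weightedCost_le (f := f) fun l => hle (θ l)
    _ = L * C := by simp

/-- The integrand sees the directions only through their costs, which are i.i.d. with a law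
symmetric in the pair. -/
theorem IWRPSW_comm (hd : 1 ≤ d) (hp : 1 ≤ p) (hf : Measurable f) (hκ : 0 < κ)
    (hμ : IsPp p μ) (hν : IsPp p ν) :
    IWRPSW p σ κ c L f μ ν = IWRPSW p σ κ c L f ν μ := by
  have := hμ.1
  have := hν.1
  have := isProbabilityMeasure_rpsd σ c μ ν hd hκ
  have := isProbabilityMeasure_rpsd σ c ν μ hd hκ
  have hm := (continuous_slicedCost hp hμ hν).measurable
  have hm' : Measurable fun (θ : Fin L → RPSphere d) l => slicedCost p μ ν (θ l) :=
    measurable_pi_lambda _ fun l => hm.comp (measurable_pi_apply l)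
  have key : ∀ (τ : Measure (RPSphere d)) [IsProbabilityMeasure τ],
      ∫⁻ θ : Fin L → RPSphere d, weightedCost f (fun l => slicedCost p μ ν (θ l))
        ∂(Measure.pi fun _ => τ) =
      ∫⁻ w, weightedCost f w ∂(Measure.pi fun _ : Fin L => τ.map (slicedCost p μ ν)) := by
    intro τ _
    have := Measure.isProbabilityMeasure_map (μ := τ) hm.aemeasurable
    rw [← Measure.pi_map_pi (fun _ => hm.aemeasurable),
      lintegral_map (measurable_weightedCost hf) hm']
  rw [IWRPSW_eq, IWRPSW_eq, slicedCost_comm p ν μ, key, key,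
    map_rpsd_comm_of_even σ c μ ν hκ hm (slicedCost_neg p μ ν)]

theorem IWRPSW_eq_zero_iff (hd : 1 ≤ d) (hp : 1 ≤ p) (hL : 1 ≤ L) (hf : Measurable f)
    (hfpos : ∀ t, 0 < f t) (hκ : 0 < κ) (hμ : IsPp p μ) (hν : IsPp p ν) :
    IWRPSW p σ κ c L f μ ν = 0 ↔ μ = ν := by
  have hp0 : 0 < p := by linarith
  have := hμ.1
  have := hν.1
  have := isProbabilityMeasure_rpsd σ c μ ν hd hκ
  have hc := continuous_slicedCost hp hμ hν
  have hm' : Measurable fun (θ : Fin L → RPSphere d) l => slicedCost p μ ν (θ l) :=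
    measurable_pi_lambda _ fun l => hc.measurable.comp (measurable_pi_apply l)
  rw [IWRPSW_eq, ENNReal.rpow_eq_zero_iff_of_pos (one_div_pos.2 hp0)]
  constructor
  · intro h
    have hae := (lintegral_eq_zero_iff ((measurable_weightedCost hf).comp hm')).1 h
    let l : Fin L := ⟨0, hL⟩
    have h0 : ∀ᵐ θ ∂(rpsd σ κ c μ ν), slicedCost p μ ν θ = 0 := by
      -- One direction among the `L` has the slicing law as its marginal, so the statement transfers
      -- from the product.
      rw [← (measurePreserving_eval (fun _ : Fin L => rpsd σ κ c μ ν) l).map_eq]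
      refine (ae_map_iff (measurable_pi_apply l).aemeasurable
        (measurableSet_eq_fun hc.measurable measurable_const)).2 ?_
      filter_upwards [hae] with θ hθ
      exact eq_zero_of_weightedCost_eq_zero hfpos hθ l
    exact eq_of_slicedCost_eq_zero hp
      (eq_zero_of_ae_rpsd_eq_zero σ c μ ν hκ hc (slicedCost_neg p μ ν) h0)
  · rintro rfl
    simp [slicedCost_self hp0, weightedCost]

end Distances

theorem theorem1 (d : ℕ) (hd : 1 ≤ d) (p : ℝ) (hp : 1 ≤ p) (L : ℕ) (hL : 1 ≤ L)
    (f : ℝ≥0 → ℝ≥0) (hf : Measurable f) (hfpos : ∀ t, 0 < f t)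
    (σ : SphericalFamily) (κ : ℝ) (hκ : 0 < κ) (c : RPSpace d) :
    -- semi-metric properties on `P_p(ℝ^d)`
    (∀ μ ν : Measure (RPSpace d), IsPp p μ → IsPp p ν →
      (0 ≤ RPSW p σ κ c μ ν ∧ RPSW p σ κ c μ ν < ∞) ∧
      (0 ≤ IWRPSW p σ κ c L f μ ν ∧ IWRPSW p σ κ c L f μ ν < ∞) ∧
      RPSW p σ κ c μ ν = RPSW p σ κ c ν μ ∧
      IWRPSW p σ κ c L f μ ν = IWRPSW p σ κ c L f ν μ ∧
      (RPSW p σ κ c μ ν = 0 ↔ μ = ν) ∧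
      (IWRPSW p σ κ c L f μ ν = 0 ↔ μ = ν)) ∧
    -- the reflection identity of the location-scale family
    (∀ x y : RPSpace d, x ≠ y → ∀ θ : RPSphere d,
      σ.density κ (sphereProj c (x - y)) θ = σ.density κ (sphereProj c (y - x)) (-θ)) ∧
    -- the quasi-triangle inequality, between finite quantities
    (∀ μ₁ μ₂ μ₃ : Measure (RPSpace d), IsPp p μ₁ → IsPp p μ₂ → IsPp p μ₃ →
      RPSWWith p σ κ c μ₁ μ₃ μ₁ μ₂ < ∞ ∧ RPSWWith p σ κ c μ₃ μ₂ μ₁ μ₂ < ∞ ∧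
      RPSW p σ κ c μ₁ μ₂ ≤ RPSWWith p σ κ c μ₁ μ₃ μ₁ μ₂ + RPSWWith p σ κ c μ₃ μ₂ μ₁ μ₂) := by
  refine ⟨fun μ ν hμ hν => ⟨⟨zero_le, ?_⟩, ⟨zero_le, IWRPSW_lt_top σ c hd hp hκ hμ hν⟩,
    RPSW_comm σ c hp hκ hμ hν, IWRPSW_comm σ c hd hp hf hκ hμ hν,
    RPSW_eq_zero_iff σ c hp hκ hμ hν, IWRPSW_eq_zero_iff σ c hd hp hL hf hfpos hκ hμ hν⟩,
    fun x y hxy θ => ?_, fun μ₁ μ₂ μ₃ h₁ h₂ h₃ => ?_⟩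
  · have := hμ.1
    have := hν.1
    have := isProbabilityMeasure_rpsd σ c μ ν hd hκ
    exact slicedW_lt_top hp _ hμ hν
  · rw [← neg_sub x y, sphereProj_neg (sub_ne_zero.2 hxy), σ.density_neg_neg]
  · have := h₁.1
    have := h₂.1
    have := isProbabilityMeasure_rpsd σ c μ₁ μ₂ hd hκ
    exact ⟨slicedW_lt_top hp _ h₁ h₃, slicedW_lt_top hp _ h₃ h₂, slicedW_triangle hp _ h₁ h₂ h₃⟩
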